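/- Fix a finite alphabet $\Sigma$ of statements, each $a\in\Sigma$ having a semantics $[\![a]\!]\subseteq St\times St$ over a set $St$ of states, extended to traces $\sigma\in\Sigma^*$ by composition of relations. A program is a language $P\subseteq\Sigma^*$; write $\sigma^{-1}P=\{\tau \mid \sigma\tau\in P\}$. The maximal contextual semi-independence relation and the maximal sound contextual semi-independence relation of $P$ are $$\mathcal I_P(\sigma)=\{(a,b)\mid a\ne b,\ (\sigma ab)^{-1}P\subseteq(\sigma ba)^{-1}P\},\qquad \mathcal I^{\mathrm{sound}}_P(\sigma)=\mathcal I_P(\sigma)\setminus\{(a,b)\mid [\![\sigma ab]\!]\not\subseteq[\![\sigma ba]\!]\}.$$ For $\mathcal I:\Sigma^*\to\mathcal P(\Sigma\times\Sigma)$ and an assignment $O$ of a linear order on $\Sigma$ to every $\sigma\in\Sigma^*$, where $(a,b)\in O(\sigma)$ (with $a\neq b$) means that $\sigma a$ is explored after $\sigma b$, let $$\mathrm{Red}_{\mathcal I,O}(P)=P\setminus\{\sigma a\rho b\upsilon\mid (a,b)\in O(\sigma),\ (c,b)\in\mathcal I(\sigma\tau)\text{ for every non-empty prefix }\tau c\text{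 of }a\rho\ (\tau\in\Sigma^*,\,c\in\Sigma)\},$$ and let $\mathrm{CRed}_{\mathcal I}(P)=\{\mathrm{Red}_{\mathcal I,O}(P)\mid O\}$. A looping tree automaton (LTA) consists of a finite set $Q$ of states, a transition relation $\Delta\subseteq Q\times\{\bot,\top\}\times(\Sigma\to Q)$ and an initial state $q_0\in Q$. It accepts a language $L\subseteq\Sigma^*$ if there is a map $r:\Sigma^*\to Q$ with $r(\epsilon)=q_0$ and $(r(w),\,w\in L,\,\lambda a.\,r(wa))\in\Delta$ for all $w\in\Sigma^*$. A set of languages is LTA-representable if it is exactly the set of languages accepted by some LTA. **Theorem.** $\mathrm{CRed}_{\mathcal I^{\mathrm{sound}}_P}(P)$ is in general not LTA-representable, even for regular programs $P$: there is a regular program $P$ such that no LTA represents $\mathrm{CRed}_{\mathcal I^{\mathrm{sound}}_P}(P)$. Moreover, $P$ can be chosen as a program over finitely many integer variables (with $St=\mathbb Z^n$) whose statements are of the forms $x\leftarrow c$, $x\leftarrow x+c$, $\mathtt{assume}\ x=c$ and $\mathtt{assume}\ x\neq c$ with $c\in\mathbb Z$, with their usual semantics. -/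

import Mathlib

/-! ### Traces and their semantics -/

namespace ContextualReduction

/-- The semantics of a trace: the composition, from left to right, of the semantics of its
statements. -/
def traceSem {A St : Type*} (sem : A → SetRel St St) : List A → SetRel St St
  | [] => SetRel.id
  | a :: w => (sem a).comp (traceSem sem w)

/-! ### Contextual semi-independence -/

/-- The maximal contextual semi-independence relation `𝓘_P` of a program `P`; the relation is
indexed by the context, that is, by the trace executed so far. -/
def maxIndep {A : Type*} (P : Language A) (σ : List A) : Set (A × A) :=
  {p | p.1 ≠ p.2 ∧
    P.leftQuotient (σ ++ [p.1, p.2]) ≤ P.leftQuotient (σ ++ [p.2, p.1])}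

/-- The maximal sound contextual semi-independence relation of a program `P`: the pairs `(a, b)`
with `⟦σab⟧ ⊈ ⟦σba⟧` are removed from `𝓘_P(σ)`. -/
def maxSoundIndep {A St : Type*} (sem : A → SetRel St St) (P : Language A) (σ : List A) :
    Set (A × A) :=
  maxIndep P σ \
    {p | ¬ traceSem sem (σ ++ [p.1, p.2]) ⊆ traceSem sem (σ ++ [p.2, p.1])}

/-! ### Contextual reductions -/

/-- The traces `σ a ρ b υ` that are pruned by the contextual relation `I` under the exploration
order `O`. Here `(O σ).lt a b` means that at node `σ` the child `σ a` is explored after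
`σ b`. -/
def pruned {A : Type*} (I : List A → Set (A × A)) (O : List A → LinearOrder A) : Language A :=
  {w | ∃ (σ : List A) (a : A) (ρ : List A) (b : A) (υ : List A),
    w = σ ++ a :: ρ ++ b :: υ ∧ (O σ).lt a b ∧
    ∀ (τ : List A) (c : A), τ ++ [c] <+: a :: ρ → (c, b) ∈ I (σ ++ τ)}

/-- The reduction of the program `P` given by the contextual relation `I` and the exploration
order `O`. -/
def red {A : Type*} (P : Language A) (I : List A → Set (A × A))
    (O : List A → LinearOrder A) : Language A :=
  {w | w ∈ P ∧ w ∉ pruned I O}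

/-- The set of all contextual reductions of `P` given by `I`. -/
def CRed {A : Type*} (I : List A → Set (A × A)) (P : Language A) : Set (Language A) :=
  {L | ∃ O : List A → LinearOrder A, L = red P I O}

/-! ### Looping tree automata -/

/-- A looping tree automaton over `|A|`-ary trees labelled by truth values, with state set `Q`. -/
structure LTA (A Q : Type*) where
  /-- The transition relation. -/
  trans : Set (Q × Prop × (A → Q))
  /-- The initial state. -/
  start : Q

/-- `r` is a run of the automaton `M` on the tree that encodes the language `L`. -/
def LTA.IsRun {A Q : Type*} (M : LTA A Q) (L : Language A) (r : List A → Q) : Prop :=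
  r [] = M.start ∧ ∀ w : List A, (r w, w ∈ L, fun a => r (w ++ [a])) ∈ M.trans

/-- The set of languages accepted by a looping tree automaton. -/
def LTA.accepts {A Q : Type*} (M : LTA A Q) : Set (Language A) :=
  {L | ∃ r : List A → Q, M.IsRun L r}

/-- A set of languages is LTA-representable if it is the set of languages accepted by some looping
tree automaton with finitely many states. -/
def LTARepresentable {A : Type*} (𝓛 : Set (Language A)) : Prop :=
  ∃ (Q : Type) (_ : Finite Q) (M : LTA A Q), M.accepts = 𝓛

/-! ### Integer programs -/

/-- Basic statements over `n` integer variables. -/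
inductive Stmt (n : ℕ) : Type
  /-- `x ← c` -/
  | assign (x : Fin n) (c : ℤ)
  /-- `x ← x + c` -/
  | add (x : Fin n) (c : ℤ)
  /-- `assume x = c` -/
  | assumeEq (x : Fin n) (c : ℤ)
  /-- `assume x ≠ c` -/
  | assumeNe (x : Fin n) (c : ℤ)

/-- The semantics of the basic statements, over states that assign an integer to each variable. -/
def Stmt.sem {n : ℕ} : Stmt n → SetRel (Fin n → ℤ) (Fin n → ℤ)
  | .assign x c => {p | p.2 = Function.update p.1 x c}
  | .add x c => {p | p.2 = Function.update p.1 x (p.1 x + c)}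
  | .assumeEq x c => {p | p.2 = p.1 ∧ p.1 x = c}
  | .assumeNe x c => {p | p.2 = p.1 ∧ p.1 x ≠ c}

end ContextualReduction

namespace ContextualReduction

/-! Soundness of a swap may depend on a counter value, which a finite automaton cannot track. After
`a iⁿ dᵐ` the variable equals `n - m`. There `ab` (reset, then test for zero) always succeeds,
whereas `ba` succeeds only if `n = m`. If `n = m`, both orders are soundly interchangeable, so every
reduction prunes one of the two words (`not_both_mem_red`). If `n ≠ m`, replacing `ab` by `ba` is
unsound, and a suitable exploration order keeps both words (`both_mem_red`).

An LTA run on that reduction takes the same state at `a iⁿ` and `a iᵏ` for some `n ≠ k`. Grafting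
the subtree at the former onto the latter (`LTA.IsRun.exists_pump`) gives an accepted language with
both words after `a iᵏ dᵏ`, hence not a reduction. -/

theorem traceSem_append {A St : Type*} (sem : A → SetRel St St) (u v : List A) :
    traceSem sem (u ++ v) = (traceSem sem u).comp (traceSem sem v) := by
  induction u with
  | nil => simp [traceSem]
  | cons a u ih => simp [traceSem, ih, SetRel.comp_assoc]

/-- The set of languages accepted by a looping tree automaton is closed under replacing the subtree
at `u₂` by the subtree at `u₁` if some run visits both positions in the same state. -/
theorem LTA.IsRun.exists_pump {A Q : Type*} {M : LTA A Q} {L : Language A} {r : List A → Q}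
    (h : M.IsRun L r) {u₁ u₂ : List A} (hr : r u₁ = r u₂) :
    ∃ L' ∈ M.accepts, ∀ v, u₂ ++ v ∈ L' ↔ u₁ ++ v ∈ L := by
  classical
  -- Positions below `u₂` are redirected to the matching positions below `u₁`; `r ∘ f` is then a run
  -- on the preimage of `L` under `f`.
  let f : List A → List A := fun w => if u₂ <+: w then u₁ ++ w.drop u₂.length else w
  have hf : ∀ v, f (u₂ ++ v) = u₁ ++ v := fun v => by simp [f]
  have hf' : ∀ w, ¬ u₂ <+: w → f w = w := fun w hw => by simp [f, hw]
  have hstep : ∀ w a, r (f (w ++ [a])) = r (f w ++ [a]) := by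
    intro w a
    by_cases hw : u₂ <+: w
    · obtain ⟨v, rfl⟩ := hw
      rw [List.append_assoc, hf, hf, List.append_assoc]
    · rw [hf' w hw]
      by_cases hwa : u₂ <+: w ++ [a]
      -- The only edge entering the grafted subtree ends at `u₂` itself; here the equality of states
      -- is needed.
      · have heq : u₂ = w ++ [a] := (List.prefix_concat_iff.1 hwa).resolve_right hw
        have := hf []
        rw [List.append_nil, List.append_nil] at this
        rw [← heq, this, hr]
      · rw [hf' _ hwa]
  refine ⟨{w | f w ∈ L}, ⟨fun w => r (f w), ?_, fun w => ?_⟩, fun v => ?_⟩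
  · change r (f []) = M.start
    by_cases hw : u₂ <+: []
    · obtain rfl := List.prefix_nil.1 hw
      have := hf []
      simp only [List.append_nil] at this
      exact (congrArg r this).trans (hr.trans h.1)
    · rw [hf' _ hw, h.1]
  · simp only [hstep]
    exact h.2 (f w)
  · change f (u₂ ++ v) ∈ L ↔ _
    rw [hf]

/-- If the swaps that keep a word in `P` are all at its end, then pruning only compares the last two
letters of a word. -/
theorem exists_last_swap_of_mem_pruned {A : Type*} {P : Language A} {I : List A → Set (A × A)}
    {O : List A → LinearOrder A} (hI : ∀ σ, I σ ⊆ maxIndep P σ)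
    (hP : ∀ u (c b : A) v, c ≠ b → u ++ c :: b :: v ∈ P → u ++ b :: c :: v ∈ P → v = [])
    {w : List A} (hw : w ∈ P) (hpr : w ∈ pruned I O) :
    ∃ u c b, w = u ++ [c, b] ∧ (O u).lt c b ∧ (c, b) ∈ I u := by
  obtain ⟨σ, a, ρ, b, υ, rfl, hlt, hind⟩ := hpr
  have swap : ∀ (u : List A) (c : A) (v : List A), (c, b) ∈ I u → u ++ c :: b :: v ∈ P →
      u ++ b :: c :: v ∈ P ∧ v = [] := by
    intro u c v hc hm
    obtain ⟨hne, hle⟩ := hI _ hc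
    have h' : u ++ b :: c :: v ∈ P := by
      have : v ∈ P.leftQuotient (u ++ [b, c]) := hle (by
        change (u ++ [c, b]) ++ v ∈ P
        simpa using hm)
      change (u ++ [b, c]) ++ v ∈ P at this
      simpa using this
    exact ⟨h', hP u c b v hne hm h'⟩
  rcases List.eq_nil_or_concat ρ with rfl | ⟨ρ', c, rfl⟩
  · have hab := hind [] a (by simp)
    rw [List.append_nil] at hab
    obtain ⟨-, rfl⟩ := swap σ a υ hab (by simpa using hw)
    exact ⟨σ, a, b, by simp, hlt, hab⟩
  -- With `ρ` non-empty, `b` moves left past two letters, and the second swap leaves the non-empty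
  -- suffix `c :: υ`, contrary to `hP`.
  · obtain ⟨τ, c', hτ⟩ : ∃ τ c', a :: ρ' = τ ++ [c'] := by
      rcases List.eq_nil_or_concat (a :: ρ') with h | ⟨τ, c', h⟩
      · simp at h
      · exact ⟨τ, c', by simpa using h⟩
    have h₁ := hind (τ ++ [c']) c (by rw [← hτ]; simp)
    have h₂ := hind τ c' (by
      rw [← hτ]
      exact ⟨[c], by simp⟩)
    have hw' : (σ ++ (τ ++ [c'])) ++ c :: b :: υ ∈ P := by
      rw [← hτ]
      simpa using hw
    have h₃ := (swap _ c υ h₁ hw').1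
    have h₄ := (swap (σ ++ τ) c' (c :: υ) h₂ (by simpa using h₃)).2
    simp at h₄

/-! ### The program `a i* d* (a b + b a)` -/

namespace CounterProgram

/-- The statements `x ← 0`, `x ← x + 1`, `x ← x + (-1)`, `assume x = 0`. -/
def code : Fin 4 → Stmt 1 :=
  ![.assign 0 0, .add 0 1, .add 0 (-1), .assumeEq 0 0]

theorem code_injective : Function.Injective code := by
  intro j k
  fin_cases j <;> fin_cases k <;> simp [code]

/-- The alphabet of the program. -/
def alphabet : Finset (Stmt 1) := Finset.univ.map ⟨code, code_injective⟩

/-- The letter with a given number. -/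
def letter (k : Fin 4) : alphabet := ⟨code k, Finset.mem_map_of_mem _ (Finset.mem_univ k)⟩

theorem letter_bijective : Function.Bijective letter := by
  refine ⟨fun j k h => code_injective (congrArg Subtype.val h), ?_⟩
  rintro ⟨s, hs⟩
  obtain ⟨k, -, rfl⟩ := Finset.mem_map.1 hs
  exact ⟨k, rfl⟩

/-- The enumeration of the alphabet. -/
noncomputable def enum : Fin 4 ≃ alphabet := Equiv.ofBijective letter letter_bijective

@[simp] theorem enum_symm_letter (k : Fin 4) : enum.symm (letter k) = k :=
  enum.symm_apply_apply k

/-- The transition table of the automaton: `0` is initial, `1` and `2` are the loops for `i` and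
`d`, `3` and `4` await the last letter, `5` accepts and `6` is a sink. -/
def table : Fin 7 → Fin 4 → Fin 7 :=
  ![![1, 6, 6, 6], ![3, 1, 2, 4], ![3, 6, 2, 4], ![6, 6, 6, 5], ![5, 6, 6, 6], ![6, 6, 6, 6],
    ![6, 6, 6, 6]]

/-- The deterministic automaton of the program. -/
noncomputable def automaton : DFA alphabet (Fin 7) where
  step s x := table s (enum.symm x)
  start := 0
  accept := {5}

/-- The program `a i* d* (a b + b a)`. -/
noncomputable def program : Language alphabet := automaton.accepts

theorem program_isRegular : program.IsRegular := ⟨Fin 7, inferInstance, automaton, rfl⟩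

theorem mem_program {u v : List alphabet} :
    u ++ v ∈ program ↔ automaton.evalFrom (automaton.eval u) v = 5 := by
  change automaton.evalFrom _ (u ++ v) = 5 ↔ _
  rw [DFA.evalFrom_of_append]
  rfl

theorem evalFrom_sink (v : List alphabet) : automaton.evalFrom 6 v = 6 := by
  induction v with
  | nil => rfl
  | cons x v ih =>
    rw [DFA.evalFrom_cons]
    have : automaton.step 6 x = 6 :=
      (by decide : ∀ k, table 6 k = 6) (enum.symm x)
    rw [this, ih]

theorem eq_nil_of_evalFrom_five {v : List alphabet} (h : automaton.evalFrom 5 v = 5) : v = [] := by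
  cases v with
  | nil => rfl
  | cons x v =>
    rw [DFA.evalFrom_cons] at h
    have : automaton.step 5 x = 6 :=
      (by decide : ∀ k, table 5 k = 6) (enum.symm x)
    rw [this, evalFrom_sink] at h
    exact absurd h (by decide)

/-- Letters inside `a i* d*` never commute within the program, so only the closing pair can be
exchanged. The finite check `key` on the transition table shows this state by state. -/
theorem eq_nil_of_swap (u : List alphabet) (c b : alphabet) (v : List alphabet) (hne : c ≠ b)
    (h₁ : u ++ c :: b :: v ∈ program) (h₂ : u ++ b :: c :: v ∈ program) : v = [] := by
  rw [mem_program, DFA.evalFrom_cons, DFA.evalFrom_cons] at h₁ h₂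
  have key : ∀ s j k, j ≠ k → table (table s j) k = 5 ∨ table (table s j) k = 6 ∨
      table (table s k) j = 6 := by decide
  generalize automaton.eval u = s at h₁ h₂
  change automaton.evalFrom (table (table s (enum.symm c)) (enum.symm b)) v = 5 at h₁
  change automaton.evalFrom (table (table s (enum.symm b)) (enum.symm c)) v = 5 at h₂
  rcases key s (enum.symm c) (enum.symm b) (by simpa using hne) with h | h | h
  · rw [h] at h₁
    exact eq_nil_of_evalFrom_five h₁
  · rw [h, evalFrom_sink] at h₁
    exact absurd h₁ (by decide)
  · rw [h, evalFrom_sink] at h₂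
    exact absurd h₂ (by decide)

/-- The trace `a iⁿ`. -/
def up (n : ℕ) : List alphabet := letter 0 :: List.replicate n (letter 1)

/-- The trace `a iⁿ dᵐ`. -/
def context (n m : ℕ) : List alphabet := up n ++ List.replicate m (letter 2)

theorem eval_context (n m : ℕ) :
    automaton.eval (context n m) = 1 ∨ automaton.eval (context n m) = 2 := by
  have hup : ∀ n, automaton.eval (up n) = 1 := by
    intro n
    change automaton.evalFrom (table 0 (enum.symm (letter 0))) _ = 1
    rw [enum_symm_letter]
    change automaton.evalFrom 1 _ = 1
    induction n with
    | zero => rfl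
    | succ n ih =>
      rw [List.replicate_succ, DFA.evalFrom_cons]
      change automaton.evalFrom (table 1 (enum.symm (letter 1))) _ = 1
      rw [enum_symm_letter]
      exact ih
  induction m with
  | zero =>
    left
    rw [← hup n]
    simp [context]
  | succ m ih =>
    right
    rw [context, List.replicate_succ', ← List.append_assoc, DFA.eval_append_singleton]
    change table _ (enum.symm (letter 2)) = 2
    rw [enum_symm_letter]
    change table (automaton.eval (context n m)) 2 = 2
    rcases ih with h | h <;> rw [h] <;> rfl

theorem evalFrom_pair (s : Fin 7) (hs : s = 1 ∨ s = 2) (v : List alphabet) :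
    automaton.evalFrom s (letter 0 :: letter 3 :: v) = automaton.evalFrom 5 v ∧
    automaton.evalFrom s (letter 3 :: letter 0 :: v) = automaton.evalFrom 5 v := by
  simp only [DFA.evalFrom_cons]
  simp only [automaton, enum_symm_letter]
  rcases hs with rfl | rfl <;> exact ⟨rfl, rfl⟩

theorem mem_program_context (n m : ℕ) :
    context n m ++ [letter 0, letter 3] ∈ program ∧
      context n m ++ [letter 3, letter 0] ∈ program := by
  have h := evalFrom_pair _ (eval_context n m) []
  exact ⟨mem_program.2 h.1, mem_program.2 h.2⟩

theorem leftQuotient_context (n m : ℕ) :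
    program.leftQuotient (context n m ++ [letter 0, letter 3]) =
      program.leftQuotient (context n m ++ [letter 3, letter 0]) := by
  ext v
  change (context n m ++ [letter 0, letter 3]) ++ v ∈ program ↔
    (context n m ++ [letter 3, letter 0]) ++ v ∈ program
  have h := evalFrom_pair _ (eval_context n m) v
  rw [List.append_assoc, List.append_assoc, mem_program, mem_program]
  change automaton.evalFrom _ (letter 0 :: letter 3 :: v) = 5 ↔
    automaton.evalFrom _ (letter 3 :: letter 0 :: v) = 5
  rw [h.1, h.2]

/-- The semantics of the letters. -/
abbrev sem : alphabet → SetRel (Fin 1 → ℤ) (Fin 1 → ℤ) := fun a => a.1.sem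

theorem mem_sem_letter_add (k : Fin 4) (c : ℤ) (hk : code k = .add 0 c) (s t : Fin 1 → ℤ) :
    (s, t) ∈ sem (letter k) ↔ t 0 = s 0 + c := by
  simp only [sem, letter, hk]
  change t = Function.update s 0 (s 0 + c) ↔ _
  rw [funext_iff]
  simp

theorem mem_traceSem_replicate (k : Fin 4) (c : ℤ) (hk : code k = .add 0 c) (n : ℕ)
    (s t : Fin 1 → ℤ) :
    (s, t) ∈ traceSem sem (List.replicate n (letter k)) ↔ t 0 = s 0 + n * c := by
  induction n generalizing s with
  | zero =>
    change s = t ↔ _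
    rw [funext_iff]
    simp [eq_comm]
  | succ n ih =>
    rw [List.replicate_succ]
    change (∃ m, (s, m) ∈ sem (letter k) ∧ (m, t) ∈ _) ↔ _
    simp only [ih, mem_sem_letter_add k c hk]
    constructor
    · rintro ⟨m, hm, ht⟩
      rw [ht, hm]
      push_cast
      ring
    · intro ht
      refine ⟨fun _ => s 0 + c, rfl, ?_⟩
      rw [ht]
      push_cast
      ring

theorem mem_sem_assign (s t : Fin 1 → ℤ) : (s, t) ∈ sem (letter 0) ↔ t 0 = 0 := by
  change t = Function.update s 0 0 ↔ _
  rw [funext_iff]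
  simp

theorem mem_sem_assume (s t : Fin 1 → ℤ) :
    (s, t) ∈ sem (letter 3) ↔ t 0 = s 0 ∧ s 0 = 0 := by
  change t = s ∧ s 0 = 0 ↔ _
  rw [funext_iff]
  simp

theorem mem_traceSem_context (n m : ℕ) (s t : Fin 1 → ℤ) :
    (s, t) ∈ traceSem sem (context n m) ↔ t 0 = n - m := by
  rw [context, traceSem_append]
  change (∃ y, (∃ x, (s, x) ∈ sem (letter 0) ∧
    (x, y) ∈ traceSem sem (List.replicate n (letter 1))) ∧ (y, t) ∈ _) ↔ _
  simp only [mem_sem_assign, mem_traceSem_replicate 1 1 rfl, mem_traceSem_replicate 2 (-1) rfl]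
  constructor
  · rintro ⟨y, ⟨x, hx, hy⟩, ht⟩
    rw [ht, hy, hx]
    ring
  · intro ht
    refine ⟨fun _ => n, ⟨fun _ => 0, rfl, by simp⟩, ?_⟩
    rw [ht]
    ring

theorem mem_traceSem_pair (u : List alphabet) (j k : Fin 4) (s t : Fin 1 → ℤ) :
    (s, t) ∈ traceSem sem (u ++ [letter j, letter k]) ↔
      ∃ x, (s, x) ∈ traceSem sem u ∧ ∃ y, (x, y) ∈ sem (letter j) ∧ (y, t) ∈ sem (letter k) := by
  rw [traceSem_append]
  change (∃ x, (s, x) ∈ traceSem sem u ∧ ∃ y, (x, y) ∈ sem (letter j) ∧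
    ∃ z, (y, z) ∈ sem (letter k) ∧ z = t) ↔ _
  simp

/-- The reset erases the counter before the test, so `n` and `m` leave no trace; in the opposite
order the test sees `n - m`. -/
theorem mem_traceSem_assign_assume (n m : ℕ) (s t : Fin 1 → ℤ) :
    (s, t) ∈ traceSem sem (context n m ++ [letter 0, letter 3]) ↔ t 0 = 0 := by
  simp only [mem_traceSem_pair, mem_traceSem_context, mem_sem_assign, mem_sem_assume]
  constructor
  · rintro ⟨x, -, y, hy, ht, -⟩
    rw [ht, hy]
  · intro ht
    exact ⟨fun _ => n - m, rfl, fun _ => 0, rfl, ht, rfl⟩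

theorem mem_traceSem_assume_assign (n m : ℕ) (s t : Fin 1 → ℤ) :
    (s, t) ∈ traceSem sem (context n m ++ [letter 3, letter 0]) ↔ n = m ∧ t 0 = 0 := by
  simp only [mem_traceSem_pair, mem_traceSem_context, mem_sem_assign, mem_sem_assume]
  constructor
  · rintro ⟨x, hx, y, ⟨-, hx'⟩, ht⟩
    exact ⟨by omega, ht⟩
  · rintro ⟨rfl, ht⟩
    exact ⟨fun _ => 0, by simp, fun _ => 0, ⟨rfl, rfl⟩, ht⟩

theorem mem_maxSoundIndep_context_self (n : ℕ) :
    (letter 0, letter 3) ∈ maxSoundIndep sem program (context n n) ∧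
      (letter 3, letter 0) ∈ maxSoundIndep sem program (context n n) := by
  have hne : letter 0 ≠ letter 3 := fun h => absurd (letter_bijective.1 h) (by decide)
  have hsem : traceSem sem (context n n ++ [letter 0, letter 3]) =
      traceSem sem (context n n ++ [letter 3, letter 0]) := by
    ext ⟨s, t⟩
    rw [mem_traceSem_assign_assume, mem_traceSem_assume_assign]
    simp
  exact ⟨⟨⟨hne, (leftQuotient_context n n).le⟩, fun h => h hsem.subset⟩,
    ⟨⟨hne.symm, (leftQuotient_context n n).ge⟩, fun h => h hsem.superset⟩⟩

theorem not_mem_maxSoundIndep_context {n m : ℕ} (hnm : n ≠ m) :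
    (letter 0, letter 3) ∉ maxSoundIndep sem program (context n m) := by
  rintro ⟨-, h⟩
  refine h fun hs => hnm ?_
  have : ((0 : Fin 1 → ℤ), (0 : Fin 1 → ℤ)) ∈
      traceSem sem (context n m ++ [letter 0, letter 3]) :=
    (mem_traceSem_assign_assume n m _ _).2 rfl
  exact ((mem_traceSem_assume_assign n m _ _).1 (hs this)).1

/-- A linear order puts one of the two letters below the other, and either choice prunes a word, as
both swaps are sound. -/
theorem not_both_mem_red (O : List alphabet → LinearOrder alphabet) (n : ℕ)
    (h₁ : context n n ++ [letter 0, letter 3] ∈ red program (maxSoundIndep sem program) O)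
    (h₂ : context n n ++ [letter 3, letter 0] ∈ red program (maxSoundIndep sem program) O) :
    False := by
  have hne : letter 0 ≠ letter 3 := fun h => absurd (letter_bijective.1 h) (by decide)
  obtain ⟨hI₁, hI₂⟩ := mem_maxSoundIndep_context_self n
  have hpr : ∀ c b : alphabet, (O (context n n)).lt c b →
      (c, b) ∈ maxSoundIndep sem program (context n n) →
      context n n ++ [c, b] ∈ pruned (maxSoundIndep sem program) O := by
    intro c b hlt hI
    refine ⟨context n n, c, [], b, [], by simp, hlt, fun τ c' hpre => ?_⟩
    have hlen := hpre.length_le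
    obtain rfl : τ = [] := by simpa using hlen
    obtain rfl : c' = c := by simpa using hpre
    simpa using hI
  rcases @lt_or_gt_of_ne _ (O (context n n)) _ _ hne with h | h
  · exact h₁.2 (hpr _ _ h hI₁)
  · exact h₂.2 (hpr _ _ h hI₂)

/-- The linear order on the letters given by their numbers. -/
noncomputable abbrev enumOrder : LinearOrder alphabet :=
  LinearOrder.lift' enum.symm enum.symm.injective

/-- The word ending in `ab` survives because its swap is unsound. The word ending in `ba` is
infeasible, so its swap is sound, and only the exploration order protects it. -/
theorem both_mem_red {n m : ℕ} (hnm : n ≠ m) :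
    context n m ++ [letter 0, letter 3] ∈
        red program (maxSoundIndep sem program) (fun _ => enumOrder) ∧
      context n m ++ [letter 3, letter 0] ∈
        red program (maxSoundIndep sem program) (fun _ => enumOrder) := by
  have hlast := fun {w : List alphabet} =>
    exists_last_swap_of_mem_pruned (O := fun _ => enumOrder) (w := w)
      (fun σ => (Set.sdiff_subset : maxSoundIndep sem program σ ⊆ _)) eq_nil_of_swap
  obtain ⟨hP₁, hP₂⟩ := mem_program_context n m
  refine ⟨⟨hP₁, fun hpr => ?_⟩, ⟨hP₂, fun hpr => ?_⟩⟩
  · obtain ⟨u, c, b, heq, -, hI⟩ := hlast hP₁ hpr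
    obtain ⟨rfl, h⟩ := List.append_inj' heq rfl
    obtain ⟨rfl, rfl⟩ : letter 0 = c ∧ letter 3 = b := by simpa using h
    exact not_mem_maxSoundIndep_context hnm hI
  · obtain ⟨u, c, b, heq, hlt, -⟩ := hlast hP₂ hpr
    obtain ⟨rfl, h⟩ := List.append_inj' heq rfl
    obtain ⟨rfl, rfl⟩ : letter 3 = c ∧ letter 0 = b := by simpa using h
    change enum.symm (letter 3) < enum.symm (letter 0) at hlt
    rw [enum_symm_letter, enum_symm_letter] at hlt
    exact absurd hlt (by decide)

theorem not_LTARepresentable_CRed :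
    ¬ LTARepresentable (CRed (maxSoundIndep sem program) program) := by
  rintro ⟨Q, _, M, hM⟩
  obtain ⟨r, hr⟩ : red program (maxSoundIndep sem program) (fun _ => enumOrder) ∈ M.accepts :=
    hM ▸ ⟨_, rfl⟩
  -- The repetition is sought before any `d` is read, so that the same continuation `dᵏ` meets the
  -- counter values `n` and `k`.
  obtain ⟨n, k, hnk, heq⟩ := Finite.exists_ne_map_eq_of_infinite fun n => r (up n)
  obtain ⟨L, hL, hpump⟩ := hr.exists_pump heq
  rw [hM] at hL
  obtain ⟨O, rfl⟩ := hL
  obtain ⟨h₁, h₂⟩ := both_mem_red hnk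
  simp only [context, List.append_assoc] at h₁ h₂
  refine not_both_mem_red O k ?_ ?_
  · rw [context, List.append_assoc]
    exact (hpump _).2 h₁
  · rw [context, List.append_assoc]
    exact (hpump _).2 h₂

end CounterProgram

end ContextualReduction

theorem mainTheorem8 :
    ∃ (n : ℕ) (A : Finset (ContextualReduction.Stmt n)) (P : Language A), P.IsRegular ∧
      ¬ ContextualReduction.LTARepresentable
        (ContextualReduction.CRed
          (ContextualReduction.maxSoundIndep (fun a : A => a.1.sem) P) P) :=
  ⟨1, ContextualReduction.CounterProgram.alphabet, ContextualReduction.CounterProgram.program,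
    ContextualReduction.CounterProgram.program_isRegular,
    ContextualReduction.CounterProgram.not_LTARepresentable_CRed⟩
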